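/- Let $n\ge 2$, let $\mathcal B\subset\mathbf R^{n^2}$ be the Birkhoff polytope (the set of doubly stochastic $n\times n$ matrices, regarded as vectors of dimension $n^2$ with the Euclidean norm), and let $\mathcal P\subset\{0,1\}^{n^2}$ be the set of permutation matrices, i.e. the extreme points of $\mathcal B$. Let $M=\max_{x,y\in\mathcal B}\|x-y\|_2$ be the diameter of $\mathcal B$, and let $\lambda$ be its pyramidal width, $$\lambda=\min_{K,\;x,\;r}\ \ \min_{S\in\mathcal S_x(K)}\ \ \max_{s\in K\cap\mathcal P,\ v\in S}\Big\langle \frac{r}{\|r\|_2},\,s-v\Big\rangle ,$$ where the first minimum is over all faces $K$ of $\mathcal B$ (including $\mathcal B$ itself), all $x\in K$ and all $r\in\operatorname{cone}(K-x)\setminus\{0\}$, and where $\mathcal S_x(K)$ is the collection of all $S\subseteq K\cap\mathcal P$ such that $x$ is a convex combination of the elements of $S$ with all weights strictly positive. Then $M=\sqrt{2n}$, $\lambda\ge 1/n$, and the eccentricity of $\mathcal B$ satisfies $$\Big(\frac{\lambda}{M}\Big)^2\ \ge\ \frac{1}{2n^3}.$$ -/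

import Mathlib

noncomputable section

namespace BirkhoffEcc

section PyramidalWidth

variable {E : Type*} [NormedAddCommGroup E] [InnerProductSpace ℝ E]

/-- `x` is a proper convex combination of all the elements of the finite set `S`:
every element of `S` receives a strictly positive weight. -/
def IsProperConvexComb (S : Finset E) (x : E) : Prop :=
  ∃ w : E → ℝ, (∀ v ∈ S, 0 < w v) ∧ ∑ v ∈ S, w v = 1 ∧ ∑ v ∈ S, w v • v = x

/-- The number `max_{s ∈ A, v ∈ S} ⟨r / ‖r‖, s - v⟩`, the width in direction `r` of the pyramid with
base `S` and with summit an element of `A` that maximizes `⟨r, ·⟩`. It is used for finite `A`, so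
that the supremum is a maximum. -/
def pyramidDirWidth (A : Set E) (S : Finset E) (r : E) : ℝ :=
  sSup {a : ℝ | ∃ s ∈ A, ∃ v ∈ S, a = inner ℝ (‖r‖⁻¹ • r) (s - v)}

/-- The pyramidal directional width of the finite set of atoms `A` in direction `r` with base
point `x`: the minimum of the widths `pyramidDirWidth A S r` over the sets `S ⊆ A` of which `x` is a
proper convex combination. -/
def pyramidalDirWidth (A : Set E) (r x : E) : ℝ :=
  sInf {a : ℝ | ∃ S : Finset E, (S : Set E) ⊆ A ∧ IsProperConvexComb S x ∧
    a = pyramidDirWidth A S r}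

/-- `r` is a nonzero element of `cone (K - x)`, where `K` is a convex set with `x ∈ K`. -/
def IsFeasibleDir (K : Set E) (x r : E) : Prop :=
  r ≠ 0 ∧ ∃ t : ℝ, 0 ≤ t ∧ ∃ y ∈ K, r = t • (y - x)

/-- The pyramidal width of the finite set of atoms `A` (equivalently, of the polytope `conv A`):
the minimum of the pyramidal directional widths of `K ∩ A` in direction `r` with base point `x`,
over all faces `K` of `conv A` (`conv A` included), all `x ∈ K` and all nonzero
`r ∈ cone (K - x)`. -/
def pyramidalWidth (A : Set E) : ℝ :=
  sInf {a : ℝ | ∃ K : Set E, IsExposed ℝ (convexHull ℝ A) K ∧ ∃ x ∈ K, ∃ r : E,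
    IsFeasibleDir K x r ∧ a = pyramidalDirWidth (K ∩ A) r x}

end PyramidalWidth

/-- An `n × n` real matrix as a vector of the Euclidean space of dimension `n ^ 2`. -/
def vectorize {n : ℕ} (X : Matrix (Fin n) (Fin n) ℝ) : EuclideanSpace ℝ (Fin n × Fin n) :=
  WithLp.toLp 2 (fun e => X e.1 e.2)

/-- The Birkhoff polytope: the vectorized doubly stochastic `n × n` matrices. -/
def birkhoffPolytope (n : ℕ) : Set (EuclideanSpace ℝ (Fin n × Fin n)) :=
  vectorize '' (doublyStochastic ℝ (Fin n) : Set (Matrix (Fin n) (Fin n) ℝ))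

/-- The vectorized `n × n` permutation matrices, the extreme points of the Birkhoff polytope. -/
def permVectors (n : ℕ) : Set (EuclideanSpace ℝ (Fin n × Fin n)) :=
  Set.range fun σ : Equiv.Perm (Fin n) => vectorize (σ.permMatrix ℝ)

end BirkhoffEcc

end

/-! For the width, take `x = ∑ w v • v` and `y ≠ x` in a face `K`. Lower the weights greedily to `a`
until `∑ a v • v ≤ y` entrywise (`exists_greedy_weights`). Each lowered atom then meets a tight
entry, so the removed mass `d` is at most the ℓ¹ distance, hence at most `n * ‖y - x‖` by
Cauchy–Schwarz over `n ^ 2` entries. The remainder `y - ∑ a v • v` is nonnegative with all row and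
column sums `d`, so it is `d • z` with `z` doubly stochastic, and `z ∈ K` because `K` is a face.
Thus `y - x = ∑ (w v - a v) • (z - v)`. Pairing with `y - x` and averaging yields an atom `v` with
`⟪y - x, z - v⟫ ≥ ‖y - x‖ / n`; passing from `z` to a best vertex of `K` only helps. -/

namespace BirkhoffEcc

/-! ### Faces of polytopes and pyramidal width -/

section Faces

variable {E : Type*} [NormedAddCommGroup E] [InnerProductSpace ℝ E]

/-- An exposed face of the convex hull of a finite set is spanned by the atoms it contains. -/
lemma subset_convexHull_inter_of_isExposed {A K : Set E} (hA : A.Finite)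
    (hK : IsExposed ℝ (convexHull ℝ A) K) : K ⊆ convexHull ℝ (K ∩ A) := by
  have hcomp : IsCompact K := hK.isCompact (hA.isCompact_convexHull ℝ)
  have hconv : Convex ℝ K := hK.convex (convex_convexHull ℝ A)
  -- Extreme points of a face are extreme in the whole hull, hence atoms; Krein–Milman then applies
  -- to `K`.
  have hsub : K.extremePoints ℝ ⊆ K ∩ A := fun p hp =>
    ⟨hp.1, extremePoints_convexHull_subset
      (hK.isExtreme.extremePoints_subset_extremePoints hp)⟩
  have hclosed : IsClosed (convexHull ℝ (K ∩ A)) :=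
    (hA.subset Set.inter_subset_right).isClosed_convexHull ℝ
  calc K = closure (convexHull ℝ (K.extremePoints ℝ)) :=
        (closure_convexHull_extremePoints hcomp hconv).symm
    _ ⊆ convexHull ℝ (K ∩ A) := closure_minimal (convexHull_mono hsub) hclosed

/-- Carathéodory gives positive weights on an affinely independent, hence injective, family. This
keeps the inner infimum from being over the empty set. -/
lemma exists_isProperConvexComb {A : Set E} {x : E} (hx : x ∈ convexHull ℝ A) :
    ∃ S : Finset E, (S : Set E) ⊆ A ∧ IsProperConvexComb S x := by
  classical
  obtain ⟨ι, _, z, w, hz, hind, hw, hw1, hwx⟩ := eq_pos_convex_span_of_mem_convexHull hx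
  have hinj := hind.injective
  refine ⟨Finset.univ.image z, by simpa using hz, Function.extend z w 0, ?_, ?_, ?_⟩
  · simp only [Finset.mem_image, Finset.mem_univ, true_and, forall_exists_index,
      forall_apply_eq_imp_iff]
    intro i
    rw [hinj.extend_apply]
    exact hw i
  · rw [Finset.sum_image fun a _ b _ h => hinj h]
    simpa only [hinj.extend_apply] using hw1
  · rw [Finset.sum_image fun a _ b _ h => hinj h]
    simpa only [hinj.extend_apply] using hwx

/-- If `y` lies in an exposed face of a convex set and `y = ∑ aᵢ vᵢ + d z` is a convex combination
with `d > 0`, then `z` lies in the face. -/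
lemma mem_of_isExposed_of_eq_sum_add_smul {C K : Set E} (hK : IsExposed ℝ C K)
    {S : Finset E} {a : E → ℝ} {d : ℝ} {y z : E} (hy : y ∈ K) (hz : z ∈ C)
    (hS : ∀ v ∈ S, v ∈ C) (ha : ∀ v ∈ S, 0 ≤ a v) (hd : 0 < d) (hsum : ∑ v ∈ S, a v + d = 1)
    (hyz : y = ∑ v ∈ S, a v • v + d • z) : z ∈ K := by
  obtain ⟨l, rfl⟩ := hK ⟨y, hy⟩
  refine ⟨hz, fun u hu => (hy.2 u hu).trans ?_⟩
  have h1 : l y = ∑ v ∈ S, a v * l v + d * l z := by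
    rw [hyz]; simp [map_sum]
  have h2 : ∑ v ∈ S, a v * l v ≤ ∑ v ∈ S, a v * l y :=
    Finset.sum_le_sum fun v hv => mul_le_mul_of_nonneg_left (hy.2 v (hS v hv)) (ha v hv)
  -- Now `l y ≤ (1 - d) * l y + d * l z`, so `z` also maximizes `l`.
  rw [← Finset.sum_mul, eq_sub_of_add_eq hsum] at h2
  nlinarith

lemma le_pyramidDirWidth {A : Set E} (hA : A.Finite) {S : Finset E} {r s v : E}
    (hs : s ∈ A) (hv : v ∈ S) :
    inner ℝ (‖r‖⁻¹ • r) (s - v) ≤ pyramidDirWidth A S r := by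
  refine le_csSup (Set.Finite.bddAbove ?_) ⟨s, hs, v, hv, rfl⟩
  refine ((hA.prod S.finite_toSet).image
    fun p : E × E => inner ℝ (‖r‖⁻¹ • r) (p.1 - p.2)).subset ?_
  rintro _ ⟨s, hs, v, hv, rfl⟩
  exact ⟨(s, v), ⟨hs, hv⟩, rfl⟩

/-- To bound the pyramidal width below by `c`, it suffices to find, for every face `K`, points
`x ≠ y` of `K` and proper decomposition `S` of `x`, a point `z` of `K` and an atom `v` of `S`
with `c * ‖y - x‖ ≤ ⟪y - x, z - v⟫`. -/
lemma le_pyramidalWidth {A : Set E} (hA : A.Finite) (hA' : A.Nontrivial) {c : ℝ}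
    (h : ∀ K, IsExposed ℝ (convexHull ℝ A) K → ∀ x ∈ K, ∀ y ∈ K, x ≠ y →
      ∀ S : Finset E, (S : Set E) ⊆ K ∩ A → IsProperConvexComb S x →
        ∃ z ∈ K, ∃ v ∈ S, c * ‖y - x‖ ≤ inner ℝ (y - x) (z - v)) :
    c ≤ pyramidalWidth A := by
  refine le_csInf ?_ ?_
  · obtain ⟨x, hx, y, hy, hxy⟩ := hA'
    exact ⟨_, _, IsExposed.refl _, x, subset_convexHull ℝ A hx, y - x,
      ⟨sub_ne_zero.2 hxy.symm, 1, zero_le_one, y, subset_convexHull ℝ A hy, by simp⟩, rfl⟩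
  rintro _ ⟨K, hK, x, hx, r, ⟨hr, t, ht, y, hy, rfl⟩, rfl⟩
  have hspan := subset_convexHull_inter_of_isExposed hA hK
  have hfin : (K ∩ A).Finite := hA.subset Set.inter_subset_right
  refine le_csInf ?_ ?_
  · obtain ⟨S, hS, hSx⟩ := exists_isProperConvexComb (hspan hx)
    exact ⟨_, S, hS, hSx, rfl⟩
  rintro _ ⟨S, hS, hSx, rfl⟩
  obtain ⟨ht0, hyx⟩ := smul_ne_zero_iff.1 hr
  have ht' : 0 < t := lt_of_le_of_ne ht (Ne.symm ht0)
  obtain ⟨z, hz, v, hv, hzv⟩ := h K hK x hx y hy (sub_ne_zero.1 hyx).symm S hS hSx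
  -- A linear functional on a hull is dominated at some atom, so `z` can be replaced by `s`.
  obtain ⟨s, hs, hzs⟩ := ((innerSL ℝ (y - x)).toLinearMap.convexOn
    (convex_convexHull ℝ (K ∩ A))).exists_ge_of_mem_convexHull (subset_convexHull ℝ _) (hspan hz)
  refine le_trans ?_ (le_pyramidDirWidth hfin hs hv)
  have hzs' : inner ℝ (y - x) z ≤ inner ℝ (y - x) s := hzs
  have hnorm : 0 < ‖y - x‖ := norm_pos_iff.2 hyx
  have hdir : ‖t • (y - x)‖⁻¹ • t • (y - x) = ‖y - x‖⁻¹ • (y - x) := by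
    rw [norm_smul, Real.norm_of_nonneg ht, smul_smul]
    congr 1
    field_simp
  rw [hdir, real_inner_smul_left, ← div_eq_inv_mul, le_div_iff₀ hnorm]
  rw [inner_sub_right] at hzv ⊢
  linarith

end Faces

/-! ### Greedy packing and the ℓ¹ bound -/

/-- Greedy packing: the weights `w` of finitely many 0-1 vectors can be lowered to weights `a`
whose combination stays below `y`, such that every vector whose weight was lowered has an entry `1`
at a position where the combination reaches `y`. -/
lemma exists_greedy_weights {ι V : Type*} [Finite ι] (f : V → ι → ℝ) (w : V → ℝ) (y : ι → ℝ)
    (hy : ∀ e, 0 ≤ y e) (S : Finset V) (hw : ∀ v ∈ S, 0 ≤ w v)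
    (hf : ∀ v ∈ S, ∀ e, f v e = 0 ∨ f v e = 1) :
    ∃ a : V → ℝ, (∀ v ∈ S, 0 ≤ a v ∧ a v ≤ w v) ∧ (∀ e, ∑ v ∈ S, a v * f v e ≤ y e) ∧
      ∀ v ∈ S, a v < w v → ∃ e, f v e = 1 ∧ ∑ u ∈ S, a u * f u e = y e := by
  classical
  cases nonempty_fintype ι
  induction S using Finset.induction_on with
  | empty => exact ⟨0, by simp, by simpa using hy, by simp⟩
  | insert v S hv ih =>
    simp only [Finset.mem_insert, forall_eq_or_imp] at hw hf
    obtain ⟨a, ha, hle, htight⟩ := ih hw.2 hf.2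
    -- `b` is the smaller of `w v` and the least slack left on the support of `v`.
    obtain ⟨b, hb0, hbw, hbe, hbt⟩ : ∃ b : ℝ, 0 ≤ b ∧ b ≤ w v ∧
        (∀ e, f v e = 1 → b ≤ y e - ∑ u ∈ S, a u * f u e) ∧
        (b < w v → ∃ e, f v e = 1 ∧ b = y e - ∑ u ∈ S, a u * f u e) := by
      by_cases hall : ∀ e, f v e = 1 → w v ≤ y e - ∑ u ∈ S, a u * f u e
      · exact ⟨w v, hw.1, le_rfl, hall, fun h => absurd h (lt_irrefl _)⟩
      · push Not at hall
        obtain ⟨e₀, he₀, hlt⟩ := hall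
        obtain ⟨e, he, hmin⟩ := Finset.exists_min_image (Finset.univ.filter fun e => f v e = 1)
          (fun e => y e - ∑ u ∈ S, a u * f u e) ⟨e₀, by simpa using he₀⟩
        simp only [Finset.mem_filter, Finset.mem_univ, true_and] at he hmin
        exact ⟨_, sub_nonneg.2 (hle e), (hmin e₀ he₀).trans hlt.le, hmin, fun _ => ⟨e, he, rfl⟩⟩
    have hsum : ∀ e, ∑ u ∈ insert v S, Function.update a v b u * f u e =
        b * f v e + ∑ u ∈ S, a u * f u e := fun e => by
      rw [Finset.sum_insert hv, Function.update_self]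
      congr 1
      refine Finset.sum_congr rfl fun u hu => ?_
      rw [Function.update_of_ne (ne_of_mem_of_not_mem hu hv)]
    have hle' : ∀ e, b * f v e + ∑ u ∈ S, a u * f u e ≤ y e := fun e => by
      rcases hf.1 e with h | h
      · simpa [h] using hle e
      · have := hbe e h
        rw [h]; linarith
    refine ⟨Function.update a v b, ?_, fun e => (hsum e).trans_le (hle' e), ?_⟩
    · simp only [Finset.mem_insert, forall_eq_or_imp, Function.update_self]
      refine ⟨⟨hb0, hbw⟩, fun u hu => ?_⟩
      rw [Function.update_of_ne (ne_of_mem_of_not_mem hu hv)]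
      exact ha u hu
    · simp only [Finset.mem_insert, forall_eq_or_imp, Function.update_self]
      refine ⟨fun h => ?_, fun u hu h => ?_⟩
      · obtain ⟨e, he, hbe'⟩ := hbt h
        refine ⟨e, he, ?_⟩
        rw [hsum, he, hbe']; ring
      · rw [Function.update_of_ne (ne_of_mem_of_not_mem hu hv)] at h
        obtain ⟨e, he, hye⟩ := htight u hu h
        -- Tight positions stay tight: the new term is nonnegative and the total still lies below
        -- `y`.
        refine ⟨e, he, (hsum e).trans (le_antisymm (hle' e) ?_)⟩
        rw [← hye]
        have : 0 ≤ f v e := by rcases hf.1 e with h | h <;> simp [h]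
        nlinarith [mul_nonneg hb0 this]

/-- The total weight removed by a greedy packing of `∑ w v • v` below `y` is at most the `ℓ¹`
distance of the two. -/
lemma sum_sub_le_sum_abs_of_tight {ι V : Type*} [Fintype ι] (f : V → ι → ℝ) (w a : V → ℝ)
    (y : ι → ℝ) (S : Finset V) (haw : ∀ v ∈ S, a v ≤ w v) (hf : ∀ v ∈ S, ∀ e, 0 ≤ f v e)
    (htight : ∀ v ∈ S, a v < w v → ∃ e, f v e = 1 ∧ ∑ u ∈ S, a u * f u e = y e) :
    ∑ v ∈ S, (w v - a v) ≤ ∑ e, |y e - ∑ v ∈ S, w v * f v e| := by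
  classical
  -- Each lowered atom has an entry 1 in `T`, so summing over `T` counts its removed weight at least
  -- once.
  set T : Finset ι := Finset.univ.filter fun e => ∑ u ∈ S, a u * f u e = y e with hT
  calc ∑ v ∈ S, (w v - a v) ≤ ∑ v ∈ S, ∑ e ∈ T, (w v - a v) * f v e := by
        refine Finset.sum_le_sum fun v hv => ?_
        have hnn : ∀ e ∈ T, 0 ≤ (w v - a v) * f v e := fun e _ =>
          mul_nonneg (sub_nonneg.2 (haw v hv)) (hf v hv e)
        rcases (haw v hv).eq_or_lt with h | h
        · simp [h]
        · obtain ⟨e, he, hye⟩ := htight v hv h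
          have := Finset.single_le_sum hnn (show e ∈ T by simpa [hT] using hye)
          simpa [he] using this
    _ = ∑ e ∈ T, (∑ v ∈ S, w v * f v e - y e) := by
        rw [Finset.sum_comm]
        refine Finset.sum_congr rfl fun e he => ?_
        rw [← (Finset.mem_filter.1 he).2, ← Finset.sum_sub_distrib]
        exact Finset.sum_congr rfl fun v _ => by ring
    _ ≤ ∑ e ∈ T, |y e - ∑ v ∈ S, w v * f v e| :=
        Finset.sum_le_sum fun e _ => by rw [abs_sub_comm]; exact le_abs_self _
    _ ≤ ∑ e, |y e - ∑ v ∈ S, w v * f v e| :=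
        Finset.sum_le_sum_of_subset_of_nonneg (Finset.subset_univ _) fun _ _ _ => abs_nonneg _

lemma sum_abs_le_sqrt_card_mul_norm {ι : Type*} [Fintype ι] (x : EuclideanSpace ℝ ι) :
    ∑ e, |x e| ≤ √(Fintype.card ι) * ‖x‖ := by
  rw [EuclideanSpace.norm_eq, ← Real.sqrt_mul (Nat.cast_nonneg _)]
  refine Real.le_sqrt_of_sq_le ?_
  simpa using sq_sum_le_card_mul_sum_sq (s := Finset.univ) (f := fun e => |x e|)

/-! ### The Birkhoff polytope and its diameter -/

variable {n : ℕ}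

lemma mem_birkhoffPolytope_iff {x : EuclideanSpace ℝ (Fin n × Fin n)} :
    x ∈ birkhoffPolytope n ↔
      (∀ e, 0 ≤ x e) ∧ (∀ i, ∑ j, x (i, j) = 1) ∧ ∀ j, ∑ i, x (i, j) = 1 := by
  constructor
  · rintro ⟨M, hM, rfl⟩
    rw [SetLike.mem_coe, mem_doublyStochastic_iff_sum] at hM
    exact ⟨fun e => hM.1 e.1 e.2, hM.2.1, hM.2.2⟩
  · intro h
    refine ⟨Matrix.of fun i j => x (i, j), ?_, rfl⟩
    rw [SetLike.mem_coe, mem_doublyStochastic_iff_sum]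
    exact ⟨fun i j => h.1 (i, j), h.2.1, h.2.2⟩

lemma convexHull_permVectors : convexHull ℝ (permVectors n) = birkhoffPolytope n := by
  let L : Matrix (Fin n) (Fin n) ℝ →ₗ[ℝ] EuclideanSpace ℝ (Fin n × Fin n) :=
    { toFun := vectorize
      map_add' := fun _ _ => rfl
      map_smul' := fun _ _ => rfl }
  have hset : permVectors n = L '' {M | ∃ σ : Equiv.Perm (Fin n), σ.permMatrix ℝ = M} := by
    ext x
    constructor
    · rintro ⟨σ, rfl⟩
      exact ⟨_, ⟨σ, rfl⟩, rfl⟩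
    · rintro ⟨_, ⟨σ, rfl⟩, rfl⟩
      exact ⟨σ, rfl⟩
  rw [hset, ← L.image_convexHull, ← doublyStochastic_eq_convexHull_permMatrix]
  rfl

lemma finite_permVectors : (permVectors n).Finite := Set.finite_range _

lemma permVectors_subset : permVectors n ⊆ birkhoffPolytope n :=
  convexHull_permVectors (n := n) ▸ subset_convexHull ℝ _

lemma vectorize_permMatrix_apply (σ : Equiv.Perm (Fin n)) (i j : Fin n) :
    vectorize (σ.permMatrix ℝ) (i, j) = if σ i = j then 1 else 0 := by
  simp [vectorize, Equiv.Perm.permMatrix, PEquiv.toMatrix_apply, Equiv.toPEquiv_apply, eq_comm]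

lemma eq_zero_or_one_of_mem_permVectors {v : EuclideanSpace ℝ (Fin n × Fin n)}
    (hv : v ∈ permVectors n) (e : Fin n × Fin n) : v e = 0 ∨ v e = 1 := by
  obtain ⟨σ, rfl⟩ := hv
  obtain ⟨i, j⟩ := e
  dsimp only
  rw [vectorize_permMatrix_apply]
  split_ifs <;> simp

lemma sum_eq_of_mem_birkhoffPolytope {x : EuclideanSpace ℝ (Fin n × Fin n)}
    (hx : x ∈ birkhoffPolytope n) : ∑ e, x e = n := by
  rw [Fintype.sum_prod_type]
  simp [(mem_birkhoffPolytope_iff.1 hx).2.1]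

lemma le_one_of_mem_birkhoffPolytope {x : EuclideanSpace ℝ (Fin n × Fin n)}
    (hx : x ∈ birkhoffPolytope n) (e : Fin n × Fin n) : x e ≤ 1 := by
  obtain ⟨M, hM, rfl⟩ := hx
  exact le_one_of_mem_doublyStochastic hM

lemma dist_le_of_mem_birkhoffPolytope {x y : EuclideanSpace ℝ (Fin n × Fin n)}
    (hx : x ∈ birkhoffPolytope n) (hy : y ∈ birkhoffPolytope n) : dist x y ≤ √(2 * n) := by
  rw [EuclideanSpace.dist_eq]
  refine Real.sqrt_le_sqrt ?_
  -- For `s, t ∈ [0, 1]`, `(s - t) ^ 2 ≤ s ^ 2 + t ^ 2 ≤ s + t`.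
  calc ∑ e, dist (x e) (y e) ^ 2 ≤ ∑ e, (x e + y e) := by
        refine Finset.sum_le_sum fun e _ => ?_
        have hx0 := (mem_birkhoffPolytope_iff.1 hx).1 e
        have hy0 := (mem_birkhoffPolytope_iff.1 hy).1 e
        have hx1 := le_one_of_mem_birkhoffPolytope hx e
        have hy1 := le_one_of_mem_birkhoffPolytope hy e
        rw [Real.dist_eq, sq_abs]
        nlinarith [mul_nonneg hx0 hy0]
    _ = 2 * n := by
        rw [Finset.sum_add_distrib, sum_eq_of_mem_birkhoffPolytope hx,
          sum_eq_of_mem_birkhoffPolytope hy]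
        ring

/-- Two permutations that agree nowhere realize the diameter. -/
lemma dist_vectorize_permMatrix {σ τ : Equiv.Perm (Fin n)} (h : ∀ i, σ i ≠ τ i) :
    dist (vectorize (σ.permMatrix ℝ)) (vectorize (τ.permMatrix ℝ)) = √(2 * n) := by
  have hσ : vectorize (σ.permMatrix ℝ) ∈ birkhoffPolytope n := permVectors_subset ⟨σ, rfl⟩
  have hτ : vectorize (τ.permMatrix ℝ) ∈ birkhoffPolytope n := permVectors_subset ⟨τ, rfl⟩
  rw [EuclideanSpace.dist_eq]
  congr 1
  calc ∑ e, dist (vectorize (σ.permMatrix ℝ) e) (vectorize (τ.permMatrix ℝ) e) ^ 2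
      = ∑ e, (vectorize (σ.permMatrix ℝ) e + vectorize (τ.permMatrix ℝ) e) := by
        refine Finset.sum_congr rfl fun ⟨i, j⟩ _ => ?_
        rw [vectorize_permMatrix_apply, vectorize_permMatrix_apply, Real.dist_eq, sq_abs]
        split_ifs with h1 h2
        · exact absurd (h1.trans h2.symm) (h i)
        all_goals norm_num
    _ = 2 * n := by
        rw [Finset.sum_add_distrib, sum_eq_of_mem_birkhoffPolytope hσ,
          sum_eq_of_mem_birkhoffPolytope hτ]
        ring

lemma exists_perm_forall_ne (hn : 2 ≤ n) : ∃ σ : Equiv.Perm (Fin n), ∀ i, σ i ≠ i := by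
  obtain ⟨m, rfl⟩ := Nat.exists_eq_add_of_le' hn
  exact ⟨Equiv.addRight 1, fun i => by simp⟩

theorem diam_birkhoffPolytope (hn : 2 ≤ n) :
    Metric.diam (birkhoffPolytope n) = √(2 * n) := by
  refine le_antisymm (Metric.diam_le_of_forall_dist_le (Real.sqrt_nonneg _)
    fun x hx y hy => dist_le_of_mem_birkhoffPolytope hx hy) ?_
  obtain ⟨σ, hσ⟩ := exists_perm_forall_ne hn
  rw [← dist_vectorize_permMatrix (σ := σ) (τ := 1) (by simpa using hσ)]
  exact Metric.dist_le_diam_of_mem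
    (Metric.isBounded_iff.2 ⟨_, fun x hx y hy => dist_le_of_mem_birkhoffPolytope hx hy⟩)
    (permVectors_subset ⟨σ, rfl⟩) (permVectors_subset ⟨1, rfl⟩)

lemma permVectors_nontrivial (hn : 2 ≤ n) : (permVectors n).Nontrivial := by
  obtain ⟨σ, hσ⟩ := exists_perm_forall_ne hn
  refine ⟨_, ⟨σ, rfl⟩, _, ⟨1, rfl⟩, dist_pos.1 ?_⟩
  have h := dist_vectorize_permMatrix (σ := σ) (τ := 1) (by simpa using hσ)
  dsimp only at h ⊢
  rw [h]
  positivity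

/-! ### The pyramidal width of the Birkhoff polytope -/

/-- A nonnegative difference between a point of the Birkhoff polytope and a combination of points of
it is a multiple of a point of the polytope. -/
lemma exists_sub_sum_eq_smul {S : Finset (EuclideanSpace ℝ (Fin n × Fin n))}
    {a : EuclideanSpace ℝ (Fin n × Fin n) → ℝ} {y : EuclideanSpace ℝ (Fin n × Fin n)}
    (hy : y ∈ birkhoffPolytope n) (hS : ∀ v ∈ S, v ∈ birkhoffPolytope n)
    (ha : ∑ v ∈ S, a v < 1) (hle : ∀ e, ∑ v ∈ S, a v * v e ≤ y e) :
    ∃ z ∈ birkhoffPolytope n, y = ∑ v ∈ S, a v • v + (1 - ∑ v ∈ S, a v) • z := by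
  have hd : 0 < 1 - ∑ v ∈ S, a v := sub_pos.2 ha
  refine ⟨(1 - ∑ v ∈ S, a v)⁻¹ • (y - ∑ v ∈ S, a v • v), ?_, ?_⟩
  · have happ : ∀ e, ((1 - ∑ v ∈ S, a v)⁻¹ • (y - ∑ v ∈ S, a v • v)) e =
        (1 - ∑ v ∈ S, a v)⁻¹ * (y e - ∑ v ∈ S, a v * v e) := fun e => by simp
    obtain ⟨-, hrow, hcol⟩ := mem_birkhoffPolytope_iff.1 hy
    refine mem_birkhoffPolytope_iff.2 ⟨fun e => ?_, fun i => ?_, fun j => ?_⟩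
    · rw [happ]
      exact mul_nonneg (inv_nonneg.2 hd.le) (sub_nonneg.2 (hle e))
    · simp only [happ]
      rw [← Finset.mul_sum, Finset.sum_sub_distrib, hrow, Finset.sum_comm]
      simp_rw [← Finset.mul_sum]
      have hmass : ∑ v ∈ S, a v * ∑ j, v (i, j) = ∑ v ∈ S, a v :=
        Finset.sum_congr rfl fun v hv => by
          rw [(mem_birkhoffPolytope_iff.1 (hS v hv)).2.1 i, mul_one]
      rw [hmass, inv_mul_cancel₀ hd.ne']
    · simp only [happ]
      rw [← Finset.mul_sum, Finset.sum_sub_distrib, hcol, Finset.sum_comm]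
      simp_rw [← Finset.mul_sum]
      have hmass : ∑ v ∈ S, a v * ∑ i, v (i, j) = ∑ v ∈ S, a v :=
        Finset.sum_congr rfl fun v hv => by
          rw [(mem_birkhoffPolytope_iff.1 (hS v hv)).2.2 j, mul_one]
      rw [hmass, inv_mul_cancel₀ hd.ne']
  · rw [smul_inv_smul₀ hd.ne']
    abel

/-- In a face of the Birkhoff polytope, `y - x` is a nonnegative combination of vectors `z - v`,
with `z` in the face and `v` in the support of a given decomposition of `x`, of total weight at most
`n * ‖y - x‖`. -/
lemma exists_sub_eq_sum_smul_sub {K : Set (EuclideanSpace ℝ (Fin n × Fin n))}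
    (hK : IsExposed ℝ (convexHull ℝ (permVectors n)) K)
    {x y : EuclideanSpace ℝ (Fin n × Fin n)} (hy : y ∈ K) (hxy : x ≠ y)
    {S : Finset (EuclideanSpace ℝ (Fin n × Fin n))} (hS : (S : Set _) ⊆ K ∩ permVectors n)
    (hx : IsProperConvexComb S x) :
    ∃ z ∈ K, ∃ c : EuclideanSpace ℝ (Fin n × Fin n) → ℝ, (∀ v ∈ S, 0 ≤ c v) ∧
      ∑ v ∈ S, c v ≤ n * ‖y - x‖ ∧ y - x = ∑ v ∈ S, c v • (z - v) := by
  obtain ⟨w, hw, hw1, rfl⟩ := hx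
  have hyB : y ∈ birkhoffPolytope n := convexHull_permVectors (n := n) ▸ hK.subset hy
  have hSP : ∀ v ∈ S, v ∈ permVectors n := fun v hv => (hS hv).2
  have hSB : ∀ v ∈ S, v ∈ birkhoffPolytope n := fun v hv => permVectors_subset (hSP v hv)
  obtain ⟨a, ha, hle, htight⟩ := exists_greedy_weights
    (fun (v : EuclideanSpace ℝ (Fin n × Fin n)) e => v e) w (fun e => y e)
    (mem_birkhoffPolytope_iff.1 hyB).1 S (fun v hv => (hw v hv).le)
    fun v hv e => eq_zero_or_one_of_mem_permVectors (hSP v hv) e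
  have hD := sum_sub_le_sum_abs_of_tight (fun (v : EuclideanSpace ℝ (Fin n × Fin n)) e => v e)
    w a (fun e => y e) S (fun v hv => (ha v hv).2)
    (fun v hv => (mem_birkhoffPolytope_iff.1 (hSB v hv)).1) htight
  have hnorm := sum_abs_le_sqrt_card_mul_norm (y - ∑ v ∈ S, w v • v)
  have hcard : √(Fintype.card (Fin n × Fin n) : ℝ) = n := by simp
  rw [hcard] at hnorm
  -- If nothing were removed, `x ≤ y` entrywise; both have total `n`, forcing `x = y`.
  have ha1 : ∑ v ∈ S, a v < 1 := by
    refine lt_of_le_of_ne (hw1 ▸ Finset.sum_le_sum fun v hv => (ha v hv).2) fun h => hxy ?_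
    have haw := (Finset.sum_eq_sum_iff_of_le fun v hv => (ha v hv).2).1 (h.trans hw1.symm)
    have hxB : ∑ v ∈ S, w v • v ∈ birkhoffPolytope n :=
      convexHull_permVectors (n := n) ▸ (convex_convexHull ℝ _).sum_mem
        (fun v hv => (hw v hv).le) hw1 fun v hv => subset_convexHull ℝ _ (hSP v hv)
    have hxe : ∀ e, (∑ v ∈ S, w v • v) e ≤ y e := fun e => by
      refine le_trans (le_of_eq ?_) (hle e)
      simp only [WithLp.ofLp_sum, Finset.sum_apply, PiLp.smul_apply, smul_eq_mul]
      exact Finset.sum_congr rfl fun v hv => by rw [haw v hv]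
    ext e
    exact (Finset.sum_eq_sum_iff_of_le fun e _ => hxe e).1
      ((sum_eq_of_mem_birkhoffPolytope hxB).trans (sum_eq_of_mem_birkhoffPolytope hyB).symm)
      e (Finset.mem_univ e)
  obtain ⟨z, hz, hyz⟩ := exists_sub_sum_eq_smul hyB hSB ha1 hle
  have hzK : z ∈ K := mem_of_isExposed_of_eq_sum_add_smul hK hy
    (convexHull_permVectors (n := n) ▸ hz) (fun v hv => hK.subset (hS hv).1)
    (fun v hv => (ha v hv).1) (sub_pos.2 ha1) (by ring) hyz
  refine ⟨z, hzK, fun v => w v - a v, fun v hv => sub_nonneg.2 (ha v hv).2, ?_, ?_⟩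
  · refine hD.trans (le_trans (le_of_eq ?_) hnorm)
    simp
  · simp only [smul_sub, Finset.sum_sub_distrib, ← Finset.sum_smul, hw1, sub_smul]
    nth_rewrite 1 [hyz]
    simp only [sub_smul]
    abel

theorem one_div_le_pyramidalWidth (hn : 2 ≤ n) : 1 / (n : ℝ) ≤ pyramidalWidth (permVectors n) := by
  refine le_pyramidalWidth finite_permVectors (permVectors_nontrivial hn)
    fun K hK x _ y hy hxy S hS hSx => ?_
  obtain ⟨z, hz, c, hc, hcn, hyx⟩ := exists_sub_eq_sum_smul_sub hK hy hxy hS hSx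
  refine ⟨z, hz, ?_⟩
  by_contra! hlt
  have hn0 : (0 : ℝ) < n := by positivity
  have hpos : 0 < ‖y - x‖ := norm_pos_iff.2 (sub_ne_zero.2 hxy.symm)
  have hsq : ‖y - x‖ ^ 2 = ∑ v ∈ S, c v * inner ℝ (y - x) (z - v) := by
    rw [← real_inner_self_eq_norm_sq]
    nth_rewrite 2 [hyx]
    simp only [inner_sum, real_inner_smul_right]
  -- One positive weight makes the averaged inequality strict, giving `‖y - x‖ ^ 2 < ‖y - x‖ ^ 2`.
  have hex : ∃ v ∈ S, 0 < c v := by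
    by_contra! h
    have : ‖y - x‖ ^ 2 = 0 := by
      rw [hsq]
      exact Finset.sum_eq_zero fun v hv => by rw [le_antisymm (h v hv) (hc v hv), zero_mul]
    exact (pow_pos hpos 2).ne' this
  have hstrict : ‖y - x‖ ^ 2 < ∑ v ∈ S, c v * (1 / n * ‖y - x‖) := by
    rw [hsq]
    obtain ⟨v, hv, hcv⟩ := hex
    exact Finset.sum_lt_sum (fun v hv => mul_le_mul_of_nonneg_left (hlt v hv).le (hc v hv))
      ⟨v, hv, mul_lt_mul_of_pos_left (hlt v hv) hcv⟩
  rw [← Finset.sum_mul] at hstrict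
  have := mul_le_mul_of_nonneg_right hcn (show 0 ≤ 1 / (n : ℝ) * ‖y - x‖ by positivity)
  have heq : (n : ℝ) * ‖y - x‖ * (1 / n * ‖y - x‖) = ‖y - x‖ ^ 2 := by field_simp
  linarith

end BirkhoffEcc

theorem mainTheorem6 (n : ℕ) (hn : 2 ≤ n) :
    Metric.diam (BirkhoffEcc.birkhoffPolytope n) = Real.sqrt (2 * (n : ℝ)) ∧
    1 / (n : ℝ) ≤ BirkhoffEcc.pyramidalWidth (BirkhoffEcc.permVectors n) ∧
    1 / (2 * (n : ℝ) ^ 3) ≤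
      (BirkhoffEcc.pyramidalWidth (BirkhoffEcc.permVectors n) /
        Metric.diam (BirkhoffEcc.birkhoffPolytope n)) ^ 2 := by
  have hdiam := BirkhoffEcc.diam_birkhoffPolytope hn
  have hwidth := BirkhoffEcc.one_div_le_pyramidalWidth hn
  refine ⟨hdiam, hwidth, ?_⟩
  have hn0 : (0 : ℝ) < n := by positivity
  rw [hdiam, div_pow, Real.sq_sqrt (by positivity), le_div_iff₀ (by positivity)]
  calc 1 / (2 * (n : ℝ) ^ 3) * (2 * n) = (1 / n) ^ 2 := by field_simp
    _ ≤ _ := pow_le_pow_left₀ (by positivity) hwidth 2
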